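/- Let $a\in\mathbb R$ and let $M:\mathbb R\to\mathbb R$ be a $C^2$ function. Consider the Kerr-Vaidya metric in ingoing coordinates $(v,r,\vartheta,\psi)\in\mathbb R\times\mathbb R_+\times(0,\pi)\times(0,2\pi)$, $$ds^2=-\Big(1-\frac{2M(v)r}{\rho^2}\Big)dv^2+2\,dv\,dr-\frac{4M(v)ar\sin^2\vartheta}{\rho^2}\,dv\,d\psi-2a\sin^2\vartheta\,dr\,d\psi+\rho^2d\vartheta^2+\frac{(r^2+a^2)^2-\Delta a^2\sin^2\vartheta}{\rho^2}\sin^2\vartheta\,d\psi^2,$$ where $\rho^2=r^2+a^2\cos^2\vartheta$ and $\Delta=r^2-2M(v)r+a^2$. Let $G^{ab}$ be its Einstein tensor, $K^a=(\partial/\partial v)^a$ the Kodama-like vector field, $J^a=G^{ab}K_b$ the associated current, and $n_a=(dr)_a$. The Noether charge at radius $r>0$ and advanced time $v$ is $$Q_K(r,v)=\frac1{8\pi}\int_{\Sigma_r,\ \underline v\le v}J^an_a\,d\mathrm{vol}_{\Sigma_r},\qquad d\mathrm{vol}_{\Sigma_r}=\sqrt{-g}\;d\underline v\,d\vartheta\,d\psi,$$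 the integral over the part up to advanced time $v$ of the hypersurface $\Sigma_r$ of constant $r$. Assume $\lim_{\underline v\to-\infty}M(\underline v)=0$ and that $M'$ and $M''$ are integrable on $(-\infty,v]$. Then for every $r>0$ the integral defining $Q_K(r,v)$ converges absolutely, and $$Q_K(r,v)=M(v)-M'(v)\left(\frac{r^2+a^2}{2a}\arctan\Big(\frac ar\Big)-\frac r2\right)\quad\text{if } a\ne0,\qquad Q_K(r,v)=M(v)\quad\text{if } a=0.$$ In particular, $\lim_{r\to\infty}Q_K(r,v)=M(v)$ for every $a\in\mathbb R$. -/

import Mathlib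

open Real Set Filter Topology MeasureTheory

noncomputable section

namespace KerrVaidya

/-- Coordinate 4-tuples; for the Kerr-Vaidya metric the coordinates are
`(v, r, ϑ, ψ) = (x 0, x 1, x 2, x 3)`. -/
abbrev Coord : Type := Fin 4 → ℝ

/-- The partial derivative `∂_μ f` at `x`. -/
def pd (μ : Fin 4) (f : Coord → ℝ) (x : Coord) : ℝ :=
  deriv (fun t : ℝ => f (Function.update x μ t)) (x μ)

section Curvature

/-- Christoffel symbols `Γ^α_{βγ} = ½ g^{αδ} (∂_β g_{δγ} + ∂_γ g_{δβ} - ∂_δ g_{βγ})` of the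
Levi-Civita connection of the metric with components `g`. -/
def christoffel (g : Coord → Matrix (Fin 4) (Fin 4) ℝ) (α β γ : Fin 4) (x : Coord) : ℝ :=
  (1 / 2) * ∑ δ, (g x)⁻¹ α δ *
    (pd β (fun y => g y δ γ) x + pd γ (fun y => g y δ β) x - pd δ (fun y => g y β γ) x)

/-- Ricci tensor
`R_{βγ} = ∂_α Γ^α_{βγ} - ∂_γ Γ^α_{βα} + Γ^α_{αδ} Γ^δ_{βγ} - Γ^α_{γδ} Γ^δ_{βα}`. -/
def ricci (g : Coord → Matrix (Fin 4) (Fin 4) ℝ) (β γ : Fin 4) (x : Coord) : ℝ :=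
  ∑ α, (pd α (christoffel g α β γ) x - pd γ (christoffel g α β α) x)
    + ∑ α, ∑ δ, (christoffel g α α δ x * christoffel g δ β γ x
        - christoffel g α γ δ x * christoffel g δ β α x)

/-- Ricci scalar `R = g^{αβ} R_{αβ}`. -/
def ricciScalar (g : Coord → Matrix (Fin 4) (Fin 4) ℝ) (x : Coord) : ℝ :=
  ∑ α, ∑ β, (g x)⁻¹ α β * ricci g α β x

/-- Einstein tensor `G_{αβ} = R_{αβ} - ½ R g_{αβ}`. -/
def einstein (g : Coord → Matrix (Fin 4) (Fin 4) ℝ) (α β : Fin 4) (x : Coord) : ℝ :=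
  ricci g α β x - (1 / 2) * ricciScalar g x * g x α β

/-- Einstein tensor with raised indices, `G^{αβ} = g^{αγ} g^{βδ} G_{γδ}`. -/
def einsteinUp (g : Coord → Matrix (Fin 4) (Fin 4) ℝ) (α β : Fin 4) (x : Coord) : ℝ :=
  ∑ γ, ∑ δ, (g x)⁻¹ α γ * (g x)⁻¹ β δ * einstein g γ δ x

/-- The current `G^{αβ} X_β`, with `X_β = g_{βγ} X^γ`, generated by a vector field `X`. -/
def current (g : Coord → Matrix (Fin 4) (Fin 4) ℝ) (X : Coord → Fin 4 → ℝ)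
    (α : Fin 4) (x : Coord) : ℝ :=
  ∑ β, einsteinUp g α β x * ∑ γ, g x β γ * X x γ

end Curvature

/-- `ρ² = r² + a² cos² ϑ`. -/
def rhoSq (a : ℝ) (x : Coord) : ℝ := x 1 ^ 2 + a ^ 2 * cos (x 2) ^ 2

/-- `Δ = r² - 2 M(v) r + a²`. -/
def Delta (a : ℝ) (M : ℝ → ℝ) (x : Coord) : ℝ := x 1 ^ 2 - 2 * M (x 0) * x 1 + a ^ 2

/-- `Γ = r² + a²`. -/
def Gam (a : ℝ) (x : Coord) : ℝ := x 1 ^ 2 + a ^ 2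

/-- Components of the Kerr-Vaidya metric in ingoing coordinates `(v, r, ϑ, ψ)`. -/
def metric (a : ℝ) (M : ℝ → ℝ) (x : Coord) : Matrix (Fin 4) (Fin 4) ℝ :=
  !![-(1 - 2 * M (x 0) * x 1 / rhoSq a x), 1, 0,
        -(2 * M (x 0) * a * x 1 * sin (x 2) ^ 2 / rhoSq a x);
     1, 0, 0, -(a * sin (x 2) ^ 2);
     0, 0, rhoSq a x, 0;
     -(2 * M (x 0) * a * x 1 * sin (x 2) ^ 2 / rhoSq a x), -(a * sin (x 2) ^ 2), 0,
        (Gam a x ^ 2 - Delta a M x * a ^ 2 * sin (x 2) ^ 2) / rhoSq a x * sin (x 2) ^ 2]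

/-- The Kodama-like vector field `K = ∂/∂v`. -/
def kodamaField (_x : Coord) : Fin 4 → ℝ := ![1, 0, 0, 0]

/-- The normal co-vector `n = dr` of the hypersurfaces of constant `r`. -/
def normalCovector (_x : Coord) : Fin 4 → ℝ := ![0, 1, 0, 0]

/-- The point of `Σ_r` with coordinates `p = (v, ϑ, ψ)`. -/
def embed (r : ℝ) (p : ℝ × ℝ × ℝ) : Coord := ![p.1, r, p.2.1, p.2.2]

/-- The part of `Σ_r` up to advanced time `v`, in the coordinates `(v, ϑ, ψ)`. -/
def sigma (v : ℝ) : Set (ℝ × ℝ × ℝ) := Iic v ×ˢ (Ioo 0 π ×ˢ Ioo 0 (2 * π))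

/-- The integrand `J^a n_a √(-g)` on `Σ_r`, where `J` is the current of the Kodama-like field.
The volume form of `Σ_r` belonging to the normal co-vector `n = dr` is `√(-g) dv dϑ dψ`, that is,
the one whose product with `dr` is the volume form of spacetime. -/
def chargeDensity (a : ℝ) (M : ℝ → ℝ) (r : ℝ) (p : ℝ × ℝ × ℝ) : ℝ :=
  (∑ α, current (metric a M) kodamaField α (embed r p) * normalCovector (embed r p) α)
    * √(-(metric a M (embed r p)).det)

/-- The Noether charge `Q_K = (8π)⁻¹ ∫_{Σ_r} J^a n_a dvol`, at radius `r` and advanced time `v`. -/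
def charge (a : ℝ) (M : ℝ → ℝ) (r v : ℝ) : ℝ :=
  1 / (8 * π) * ∫ p in sigma v, chargeDensity a M r p

end KerrVaidya

end

/-!
For any metric whose determinant does not depend on `x_μ`, the gradient `∇^β K^α` of the coordinate
field `K = ∂_μ` is a superpotential of the current: `√(-g) G^{κβ} K_β` with `κ ≠ μ` is the
coordinate divergence `∂_α (√(-g) ∇^κ K^α)`, up to a multiple of `Γ^κ_{αβ} ∂_μ g^{αβ}`. This is
Komar's identity for Killing fields, with the failure of Killing's equation kept track of.

In the Kerr-Vaidya metric `∂_v g^{αβ}` has only an `rr` component, and `Γ^r_{rr} = 0`, so for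
`κ = r` the correction vanishes. Moreover `∇^r K^ϑ = 0` and nothing depends on `ψ`, so the charge
density is a sum of a `v`- and an `r`-derivative, namely of `M P - M' F` and of `M' r sin ϑ` with
explicit profiles `P`, `F` in `(r, ϑ)`. The integrals of `P` and of `sin ϑ` over `(0, π)` are both
`2`, whence the term `M(v)`; that of `F` gives the arctangent and is `O(1 / r)`.
-/

namespace KerrVaidya

open scoped Matrix

section PartialDerivatives

variable {f f₁ f₂ : Coord → ℝ} {x : Coord} (μ : Fin 4)

theorem hasDerivAt_pd (hf : DifferentiableAt ℝ f x) :
    HasDerivAt (fun t => f (Function.update x μ t)) (pd μ f x) (x μ) := by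
  have hu := (hasDerivAt_update x μ (x μ)).differentiableAt
  exact (DifferentiableAt.comp (x μ) (by simpa using hf) hu).hasDerivAt

theorem pd_eq_fderiv (hf : DifferentiableAt ℝ f x) :
    pd μ f x = fderiv ℝ f x (Pi.single μ 1) := by
  have hf' : HasFDerivAt f (fderiv ℝ f x) (Function.update x μ (x μ)) := by
    simpa using hf.hasFDerivAt
  exact (hf'.comp_hasDerivAt (x μ) (hasDerivAt_update x μ (x μ))).deriv

theorem pd_congr (h : f₁ =ᶠ[𝓝 x] f₂) : pd μ f₁ x = pd μ f₂ x := by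
  have hu : Tendsto (Function.update x μ) (𝓝 (x μ)) (𝓝 x) := by
    simpa using (hasDerivAt_update x μ (x μ)).continuousAt.tendsto
  exact (h.comp_tendsto hu).deriv_eq

theorem contDiffAt_pd {n : WithTop ℕ∞} (hf : ContDiffAt ℝ (n + 1) f x) :
    ContDiffAt ℝ n (pd μ f) x := by
  have hdiff : ∀ᶠ y in 𝓝 x, DifferentiableAt ℝ f y :=
    ((hf.of_le le_add_self).eventually (by simp)).mono fun y hy => hy.differentiableAt (by simp)
  exact (hf.fderiv_right_succ.clm_apply contDiffAt_const).congr_of_eventuallyEq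
    (hdiff.mono fun y hy => pd_eq_fderiv μ hy)

theorem pd_mul (h₁ : DifferentiableAt ℝ f₁ x) (h₂ : DifferentiableAt ℝ f₂ x) :
    pd μ (fun y => f₁ y * f₂ y) x = pd μ f₁ x * f₂ x + f₁ x * pd μ f₂ x :=
  ((hasDerivAt_pd μ h₁).fun_mul (hasDerivAt_pd μ h₂)).deriv.trans
    (by simp only [Function.update_eq_self])

theorem pd_sum {ι : Type*} (s : Finset ι) {F : ι → Coord → ℝ}
    (hF : ∀ i ∈ s, DifferentiableAt ℝ (F i) x) :
    pd μ (fun y => ∑ i ∈ s, F i y) x = ∑ i ∈ s, pd μ (F i) x :=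
  HasDerivAt.deriv (HasDerivAt.fun_sum fun i hi => hasDerivAt_pd (x := x) μ (hF i hi))

theorem pd_const (c : ℝ) : pd μ (fun _ => c) x = 0 :=
  deriv_const (x μ) c

theorem pd_eq_zero_of_forall_update (hf : ∀ y t, f (Function.update y μ t) = f y) :
    pd μ f x = 0 := by
  simp only [pd, hf, deriv_const]

theorem pd_update_of_forall_update (hf : ∀ y t, f (Function.update y μ t) = f y) (ν : Fin 4)
    (t : ℝ) : pd ν f (Function.update x μ t) = pd ν f x := by
  rcases eq_or_ne ν μ with rfl | hne
  · rw [pd_eq_zero_of_forall_update ν hf, pd_eq_zero_of_forall_update ν hf]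
  · simp only [pd, Function.update_of_ne hne, Function.update_comm hne.symm, hf]

end PartialDerivatives

section MatrixCalculus

/-- The entrywise partial derivative `∂_μ A` of a matrix field. -/
noncomputable def matrixPd {m n : Type*} (μ : Fin 4) (A : Coord → Matrix m n ℝ) (x : Coord) :
    Matrix m n ℝ :=
  Matrix.of fun i j => pd μ (fun y => A y i j) x

variable {x : Coord} (μ : Fin 4)

theorem matrixPd_mul {l m n : Type*} [Fintype m] {A : Coord → Matrix l m ℝ}
    {B : Coord → Matrix m n ℝ}
    (hA : ∀ i j, DifferentiableAt ℝ (fun y => A y i j) x)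
    (hB : ∀ i j, DifferentiableAt ℝ (fun y => B y i j) x) :
    matrixPd μ (fun y => A y * B y) x = matrixPd μ A x * B x + A x * matrixPd μ B x := by
  ext i j
  simp only [matrixPd, Matrix.of_apply, Matrix.add_apply, Matrix.mul_apply,
    ← Finset.sum_add_distrib]
  rw [pd_sum μ _ fun k _ => (hA i k).fun_mul (hB k j)]
  exact Finset.sum_congr rfl fun k _ => pd_mul μ (hA i k) (hB k j)

variable {n : Type*} [Fintype n] [DecidableEq n]

theorem hasDerivAt_det {A : ℝ → Matrix n n ℝ} {A' : Matrix n n ℝ} {t : ℝ}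
    (hA : ∀ i j, HasDerivAt (fun s => A s i j) (A' i j) t) :
    HasDerivAt (fun s => (A s).det) ((A t).adjugate * A').trace t := by
  let D : ContinuousMultilinearMap ℝ (fun _ : n => n → ℝ) ℝ :=
    ⟨Matrix.detRowAlternating.toMultilinearMap, continuous_id.matrix_det⟩
  have hA' : HasDerivAt (fun s i j => A s i j) (fun i j => A' i j) t :=
    hasDerivAt_pi.2 fun i => hasDerivAt_pi.2 fun j => hA i j
  refine ((D.hasFDerivAt (A t)).comp_hasDerivAt t hA').congr_deriv ?_
  calc D.linearDeriv (A t) A' = ∑ i, ((A t).updateRow i (A' i)).det :=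
        D.linearDeriv_apply (A t) A'
    _ = ∑ i, ∑ j, (A t).adjugate j i * A' i j := by
        simp only [← Matrix.cramer_transpose_apply, Matrix.cramer_eq_adjugate_mulVec,
          ← Matrix.adjugate_transpose]
        rfl
    _ = ((A t).adjugate * A').trace := Finset.sum_comm

theorem contDiffAt_det {k : WithTop ℕ∞} {A : Coord → Matrix n n ℝ}
    (hA : ∀ i j, ContDiffAt ℝ k (fun y => A y i j) x) :
    ContDiffAt ℝ k (fun y => (A y).det) x := by
  simp only [Matrix.det_apply']
  exact ContDiffAt.sum fun σ _ => contDiffAt_const.mul (contDiffAt_prod fun i _ => hA _ _)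

theorem contDiffAt_inv {k : WithTop ℕ∞} {A : Coord → Matrix n n ℝ}
    (hA : ∀ i j, ContDiffAt ℝ k (fun y => A y i j) x) (hdet : (A x).det ≠ 0) (i j : n) :
    ContDiffAt ℝ k (fun y => (A y)⁻¹ i j) x := by
  simp only [Matrix.inv_def, Ring.inverse_eq_inv', Matrix.smul_apply, smul_eq_mul,
    Matrix.adjugate_apply]
  refine ((contDiffAt_det hA).inv hdet).mul (contDiffAt_det fun k l => ?_)
  by_cases hk : k = j <;> simp [Matrix.updateRow_apply, hk, contDiffAt_const, hA]

variable {A : Coord → Matrix n n ℝ}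

theorem matrixPd_inv (hA : ∀ i j, ContDiffAt ℝ 1 (fun y => A y i j) x) (hdet : (A x).det ≠ 0) :
    matrixPd μ (fun y => (A y)⁻¹) x = -((A x)⁻¹ * matrixPd μ A x * (A x)⁻¹) := by
  have hone : ∀ᶠ y in 𝓝 x, A y * (A y)⁻¹ = 1 :=
    ((contDiffAt_det hA).continuousAt.eventually_ne hdet).mono fun y hy =>
      Matrix.mul_nonsing_inv _ hy.isUnit
  have hconst : matrixPd μ (fun y => A y * (A y)⁻¹) x = 0 := by
    ext i j
    exact (pd_congr μ (hone.mono fun y hy => congrFun₂ hy i j)).trans (pd_const μ _)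
  rw [matrixPd_mul μ (fun i j => (hA i j).differentiableAt one_ne_zero)
    fun i j => (contDiffAt_inv hA hdet i j).differentiableAt one_ne_zero] at hconst
  calc matrixPd μ (fun y => (A y)⁻¹) x
      = (A x)⁻¹ * (A x * matrixPd μ (fun y => (A y)⁻¹) x) :=
        (Matrix.nonsing_inv_mul_cancel_left _ _ hdet.isUnit).symm
    _ = -((A x)⁻¹ * matrixPd μ A x * (A x)⁻¹) := by
        rw [eq_neg_of_add_eq_zero_right hconst, mul_neg, mul_assoc]

theorem pd_det (hA : ∀ i j, DifferentiableAt ℝ (fun y => A y i j) x) (hdet : (A x).det ≠ 0) :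
    pd μ (fun y => (A y).det) x = (A x).det * ((A x)⁻¹ * matrixPd μ A x).trace := by
  have hadj : (A x).adjugate = (A x).det • (A x)⁻¹ := by
    rw [Matrix.inv_def, Ring.inverse_eq_inv', smul_inv_smul₀ hdet]
  have h := hasDerivAt_det (A' := matrixPd μ A x) fun i j => hasDerivAt_pd μ (hA i j)
  rw [Function.update_eq_self, hadj, Matrix.smul_mul, Matrix.trace_smul, smul_eq_mul] at h
  exact h.deriv

end MatrixCalculus

section ChristoffelMatrices

variable (g : Coord → Matrix (Fin 4) (Fin 4) ℝ) (μ : Fin 4) (x : Coord)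

/-- The Christoffel symbols `Γ^α_{βμ}` for fixed `μ`, as a matrix with row index `α` and column
index `β`; it represents the endomorphism `∇(∂_μ)`. -/
noncomputable def connectionMatrix : Matrix (Fin 4) (Fin 4) ℝ :=
  Matrix.of fun α β => christoffel g α β μ x

/-- The components `∂_β K_δ - ∂_δ K_β`, with row index `δ` and column index `β`, of the exterior
derivative of the covector field `K_δ = g_{δμ}` dual to `∂_μ`. -/
noncomputable def loweredCurl : Matrix (Fin 4) (Fin 4) ℝ :=
  Matrix.of fun δ β => pd β (fun y => g y δ μ) x - pd δ (fun y => g y β μ) x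

/-- The contravariant gradient `∇^β K^α` of the coordinate field `K = ∂_μ`, with row index `α` and
column index `β`. -/
noncomputable def fieldGradient : Matrix (Fin 4) (Fin 4) ℝ :=
  connectionMatrix g μ x * (g x)⁻¹

theorem connectionMatrix_eq :
    connectionMatrix g μ x = (1 / 2 : ℝ) • ((g x)⁻¹ * (loweredCurl g μ x + matrixPd μ g x)) := by
  ext α β
  simp only [connectionMatrix, christoffel, loweredCurl, matrixPd, Matrix.smul_apply,
    Matrix.mul_apply, Matrix.add_apply, Matrix.of_apply, smul_eq_mul]
  congr! 3
  ring

theorem transpose_loweredCurl : (loweredCurl g μ x)ᵀ = -loweredCurl g μ x := by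
  ext δ β
  simp [loweredCurl]

variable {g μ x}

theorem isSymm_matrixPd (hsymm : ∀ y, (g y).IsSymm) : (matrixPd μ g x).IsSymm := by
  ext i j
  simp only [matrixPd, Matrix.transpose_apply, Matrix.of_apply, fun y => (hsymm y).apply j i]

theorem christoffel_symm (hsymm : ∀ y, (g y).IsSymm) (α β γ : Fin 4) :
    christoffel g α β γ x = christoffel g α γ β x := by
  simp only [christoffel, fun y => (hsymm y).apply γ β]
  congr! 3
  ring

theorem contDiffAt_christoffel {k : WithTop ℕ∞}
    (hg : ∀ i j, ContDiffAt ℝ (k + 1) (fun y => g y i j) x) (hdet : (g x).det ≠ 0)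
    (α β γ : Fin 4) : ContDiffAt ℝ k (christoffel g α β γ) x :=
  contDiffAt_const.mul <| ContDiffAt.sum fun _ _ =>
    (contDiffAt_inv (fun i j => (hg i j).of_le le_self_add) hdet _ _).mul <|
      ((contDiffAt_pd _ (hg _ _)).add (contDiffAt_pd _ (hg _ _))).sub (contDiffAt_pd _ (hg _ _))

theorem fieldGradient_eq (hg : ∀ i j, ContDiffAt ℝ 1 (fun y => g y i j) x)
    (hdet : (g x).det ≠ 0) :
    fieldGradient g μ x = (1 / 2 : ℝ) •
      ((g x)⁻¹ * loweredCurl g μ x * (g x)⁻¹ - matrixPd μ (fun y => (g y)⁻¹) x) := by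
  rw [fieldGradient, connectionMatrix_eq, matrixPd_inv μ hg hdet, sub_neg_eq_add,
    Matrix.smul_mul, mul_add, add_mul]

theorem fieldGradient_add_transpose (hg : ∀ i j, ContDiffAt ℝ 1 (fun y => g y i j) x)
    (hsymm : ∀ y, (g y).IsSymm) (hdet : (g x).det ≠ 0) :
    fieldGradient g μ x + (fieldGradient g μ x)ᵀ = -matrixPd μ (fun y => (g y)⁻¹) x := by
  have hinv : ∀ y, ((g y)⁻¹).IsSymm := fun y => (hsymm y).inv
  rw [fieldGradient_eq hg hdet]
  simp only [Matrix.transpose_smul, Matrix.transpose_sub, Matrix.transpose_mul,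
    transpose_loweredCurl, (hinv x).eq, (isSymm_matrixPd hinv).eq, mul_neg, neg_mul, ← mul_assoc]
  module

theorem trace_connectionMatrix (hg : ∀ i j, DifferentiableAt ℝ (fun y => g y i j) x)
    (hsymm : ∀ y, (g y).IsSymm) (hdet : (g x).det ≠ 0) :
    (connectionMatrix g μ x).trace = pd μ (fun y => (g y).det) x / (2 * (g x).det) := by
  have hcurl : ((g x)⁻¹ * loweredCurl g μ x).trace = 0 := by
    have h := Matrix.trace_transpose ((g x)⁻¹ * loweredCurl g μ x)
    rw [Matrix.transpose_mul, transpose_loweredCurl, (hsymm x).inv.eq, neg_mul, Matrix.trace_neg,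
      Matrix.trace_mul_comm] at h
    linarith
  rw [connectionMatrix_eq, Matrix.trace_smul, mul_add, Matrix.trace_add, hcurl, pd_det μ hg hdet]
  simp only [smul_eq_mul]
  field

theorem pd_sqrt_neg_det (hg : ∀ i j, ContDiffAt ℝ 1 (fun y => g y i j) x)
    (hsymm : ∀ y, (g y).IsSymm) (hdet : (g x).det < 0) :
    pd μ (fun y => √(-(g y).det)) x = √(-(g x).det) * (connectionMatrix g μ x).trace := by
  have hd : DifferentiableAt ℝ (fun y => (g y).det) x :=
    (contDiffAt_det hg).differentiableAt one_ne_zero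
  have hsqrt := ((hasDerivAt_pd μ hd).fun_neg.sqrt (by simpa using hdet.ne)).deriv
  rw [Function.update_eq_self] at hsqrt
  have hpos : 0 < √(-(g x).det) := sqrt_pos.2 (neg_pos.2 hdet)
  have hsq : (g x).det = -√(-(g x).det) ^ 2 := by rw [sq_sqrt (neg_pos.2 hdet).le, neg_neg]
  refine hsqrt.trans ?_
  rw [trace_connectionMatrix (fun i j => (hg i j).differentiableAt one_ne_zero) hsymm hdet.ne]
  nth_rw 3 [hsq]
  field

end ChristoffelMatrices

section CurrentIdentity

variable {g : Coord → Matrix (Fin 4) (Fin 4) ℝ} {μ : Fin 4} {x : Coord}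

theorem current_eq_ricci (X : Coord → Fin 4 → ℝ) (hsymm : (g x).IsSymm) (hdet : (g x).det ≠ 0)
    (κ : Fin 4) :
    current g X κ x =
      ∑ γ, (g x)⁻¹ κ γ * ∑ δ, ricci g γ δ x * X x δ - 1 / 2 * ricciScalar g x * X x κ := by
  let Ric : Matrix (Fin 4) (Fin 4) ℝ := Matrix.of fun γ δ => ricci g γ δ x
  let Ein : Matrix (Fin 4) (Fin 4) ℝ := Matrix.of fun γ δ => einstein g γ δ x
  have hEin : Ein = Ric - (1 / 2 * ricciScalar g x) • g x := rfl
  have hup : Matrix.of (fun α β => einsteinUp g α β x) = (g x)⁻¹ * Ein * (g x)⁻¹ := by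
    ext α β
    simp only [einsteinUp, Matrix.of_apply, Matrix.mul_apply, Finset.sum_mul]
    rw [Finset.sum_comm]
    refine Finset.sum_congr rfl fun δ _ => Finset.sum_congr rfl fun γ _ => ?_
    rw [hsymm.inv.apply δ β]
    exact mul_right_comm _ _ _
  calc current g X κ x = (((g x)⁻¹ * Ein * (g x)⁻¹) *ᵥ (g x *ᵥ X x)) κ := by rw [← hup]; rfl
    _ = (((g x)⁻¹ * Ein) *ᵥ X x) κ := by
        rw [Matrix.mulVec_mulVec, Matrix.nonsing_inv_mul_cancel_right _ _ hdet.isUnit]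
    _ = ((g x)⁻¹ *ᵥ (Ric *ᵥ X x)) κ - 1 / 2 * ricciScalar g x * X x κ := by
        rw [hEin, mul_sub, Matrix.mul_smul, Matrix.nonsing_inv_mul _ hdet.isUnit,
          Matrix.sub_mulVec, Matrix.smul_mulVec, Matrix.one_mulVec, ← Matrix.mulVec_mulVec]
        rfl

theorem ricci_eq_sum_connectionMatrix (hg : ∀ i j, ContDiffAt ℝ 2 (fun y => g y i j) x)
    (hsymm : ∀ y, (g y).IsSymm) (hdet : (g x).det ≠ 0) (β : Fin 4) :
    ricci g β μ x = ∑ α, (matrixPd α (connectionMatrix g μ) x +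
        (connectionMatrix g α x).trace • connectionMatrix g μ x -
        connectionMatrix g μ x * connectionMatrix g α x) α β -
      pd μ (fun y => (connectionMatrix g β y).trace) x := by
  have htrace : pd μ (fun y => (connectionMatrix g β y).trace) x =
      ∑ α, pd μ (christoffel g α β α) x := by
    simp only [Matrix.trace, Matrix.diag, connectionMatrix, Matrix.of_apply,
      fun α y => christoffel_symm (x := y) hsymm α α β]
    exact pd_sum μ _ fun α _ =>
      (contDiffAt_christoffel (k := 1) hg hdet α β α).differentiableAt one_ne_zero
  have hswap : ∑ α, ∑ δ, christoffel g α α δ x * christoffel g δ β μ x =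
      ∑ α, ∑ δ, christoffel g δ δ α x * christoffel g α β μ x := Finset.sum_comm
  rw [htrace, ricci, Finset.sum_sub_distrib]
  simp only [Finset.sum_sub_distrib, hswap, Matrix.sub_apply, Matrix.add_apply, Matrix.smul_apply,
    Matrix.mul_apply, Matrix.trace, Matrix.diag, connectionMatrix, matrixPd, Matrix.of_apply,
    smul_eq_mul, Finset.sum_add_distrib, Finset.sum_mul,
    fun α δ => christoffel_symm (x := x) hsymm α μ δ]
  ring

theorem pd_trace_connectionMatrix (hg : ∀ i j, ContDiffAt ℝ 1 (fun y => g y i j) x)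
    (hsymm : ∀ y, (g y).IsSymm) (hdet : (g x).det ≠ 0)
    (hinv : ∀ y t, (g (Function.update y μ t)).det = (g y).det) (β : Fin 4) :
    pd μ (fun y => (connectionMatrix g β y).trace) x = 0 := by
  have hlocal : ∀ᶠ y in 𝓝 x, (connectionMatrix g β y).trace =
      pd β (fun z => (g z).det) y / (2 * (g y).det) := by
    have hg' : ∀ᶠ y in 𝓝 x, ∀ i j, ContDiffAt ℝ 1 (fun z => g z i j) y :=
      eventually_all.2 fun i => eventually_all.2 fun j => (hg i j).eventually (by simp)
    filter_upwards [hg', (contDiffAt_det hg).continuousAt.eventually_ne hdet] with y hy hy'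
    exact trace_connectionMatrix (fun i j => (hy i j).differentiableAt one_ne_zero) hsymm hy'
  rw [pd_congr μ hlocal]
  exact pd_eq_zero_of_forall_update μ fun y t => by
    rw [hinv, pd_update_of_forall_update μ hinv]

theorem differentiableAt_connectionMatrix (hg : ∀ i j, ContDiffAt ℝ 2 (fun y => g y i j) x)
    (hdet : (g x).det ≠ 0) (i j : Fin 4) :
    DifferentiableAt ℝ (fun y => connectionMatrix g μ y i j) x :=
  (contDiffAt_christoffel (k := 1) hg hdet i j μ).differentiableAt one_ne_zero

theorem differentiableAt_inv (hg : ∀ i j, ContDiffAt ℝ 1 (fun y => g y i j) x)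
    (hdet : (g x).det ≠ 0) (i j : Fin 4) : DifferentiableAt ℝ (fun y => (g y)⁻¹ i j) x :=
  (contDiffAt_inv hg hdet i j).differentiableAt one_ne_zero

theorem matrixPd_fieldGradient (hg : ∀ i j, ContDiffAt ℝ 2 (fun y => g y i j) x)
    (hsymm : ∀ y, (g y).IsSymm) (hdet : (g x).det ≠ 0) (α : Fin 4) :
    matrixPd α (fieldGradient g μ) x =
      (matrixPd α (connectionMatrix g μ) x - connectionMatrix g μ x * connectionMatrix g α x) *
        (g x)⁻¹ - fieldGradient g μ x * (connectionMatrix g α x)ᵀ := by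
  have hg1 : ∀ i j, ContDiffAt ℝ 1 (fun y => g y i j) x := fun i j => (hg i j).of_le one_le_two
  have hcompat : matrixPd α (fun y => (g y)⁻¹) x =
      -(connectionMatrix g α x * (g x)⁻¹) - (g x)⁻¹ * (connectionMatrix g α x)ᵀ := by
    have h := fieldGradient_add_transpose (μ := α) hg1 hsymm hdet
    rw [fieldGradient, Matrix.transpose_mul, (hsymm x).inv.eq] at h
    rw [← neg_eq_iff_eq_neg.2 h]
    abel
  calc matrixPd α (fieldGradient g μ) x
      = matrixPd α (connectionMatrix g μ) x * (g x)⁻¹ +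
          connectionMatrix g μ x * matrixPd α (fun y => (g y)⁻¹) x :=
        matrixPd_mul α (differentiableAt_connectionMatrix hg hdet) (differentiableAt_inv hg1 hdet)
    _ = _ := by rw [hcompat, fieldGradient]; noncomm_ring

theorem sum_fieldGradient_mul_transpose (hg : ∀ i j, ContDiffAt ℝ 1 (fun y => g y i j) x)
    (hsymm : ∀ y, (g y).IsSymm) (hdet : (g x).det ≠ 0) (κ : Fin 4) :
    ∑ α, (fieldGradient g μ x * (connectionMatrix g α x)ᵀ) α κ =
      -(1 / 2) * ∑ α, ∑ ε, christoffel g κ α ε x * pd μ (fun y => (g y)⁻¹ α ε) x := by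
  have hT : ∀ α ε, pd μ (fun y => (g y)⁻¹ α ε) x =
      -(fieldGradient g μ x α ε + fieldGradient g μ x ε α) := fun α ε =>
    neg_eq_iff_eq_neg.1 (congrFun₂ (fieldGradient_add_transpose hg hsymm hdet) α ε).symm
  have hswap : ∑ α, ∑ ε, christoffel g κ α ε x * fieldGradient g μ x ε α =
      ∑ α, ∑ ε, christoffel g κ α ε x * fieldGradient g μ x α ε := by
    rw [Finset.sum_comm]
    simp only [fun α ε => christoffel_symm (x := x) hsymm κ α ε]
  simp only [hT, mul_neg, mul_add, Finset.sum_neg_distrib, Finset.sum_add_distrib, hswap,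
    Matrix.mul_apply, Matrix.transpose_apply, connectionMatrix, Matrix.of_apply,
    mul_comm (fieldGradient g μ x _ _), fun α ε => christoffel_symm (x := x) hsymm κ ε α]
  ring

theorem sum_pd_sqrt_neg_det_mul_fieldGradient
    (hg : ∀ i j, ContDiffAt ℝ 2 (fun y => g y i j) x) (hsymm : ∀ y, (g y).IsSymm)
    (hdet : (g x).det < 0) (hinv : ∀ y t, (g (Function.update y μ t)).det = (g y).det)
    (κ : Fin 4) :
    ∑ α, pd α (fun y => √(-(g y).det) * fieldGradient g μ y α κ) x =
      √(-(g x).det) * (∑ β, (g x)⁻¹ κ β * ricci g β μ x -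
        ∑ α, (fieldGradient g μ x * (connectionMatrix g α x)ᵀ) α κ) := by
  have hg1 : ∀ i j, ContDiffAt ℝ 1 (fun y => g y i j) x := fun i j => (hg i j).of_le one_le_two
  have hsqrt : DifferentiableAt ℝ (fun y => √(-(g y).det)) x :=
    ((contDiffAt_det hg1).differentiableAt one_ne_zero).fun_neg.sqrt (neg_pos.2 hdet).ne'
  have hT : ∀ α, DifferentiableAt ℝ (fun y => fieldGradient g μ y α κ) x := fun α => by
    simp only [fieldGradient, Matrix.mul_apply]
    exact DifferentiableAt.fun_sum fun β _ =>
      (differentiableAt_connectionMatrix hg hdet.ne α β).fun_mul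
        (differentiableAt_inv hg1 hdet.ne β κ)
  have hricci : ∑ β, (g x)⁻¹ κ β * ricci g β μ x = ∑ α, ((matrixPd α (connectionMatrix g μ) x +
      (connectionMatrix g α x).trace • connectionMatrix g μ x -
      connectionMatrix g μ x * connectionMatrix g α x) * (g x)⁻¹) α κ := by
    simp only [ricci_eq_sum_connectionMatrix hg hsymm hdet.ne,
      pd_trace_connectionMatrix hg1 hsymm hdet.ne hinv, sub_zero, Finset.sum_mul,
      Matrix.mul_apply (N := (g x)⁻¹), (hsymm x).inv.apply κ, mul_comm ((g x)⁻¹ κ _)]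
    exact Finset.sum_comm
  rw [hricci, ← Finset.sum_sub_distrib, Finset.mul_sum]
  refine Finset.sum_congr rfl fun α _ => ?_
  have hpd : pd α (fun y => fieldGradient g μ y α κ) x = matrixPd α (fieldGradient g μ) x α κ := rfl
  rw [pd_mul α hsqrt (hT α), pd_sqrt_neg_det hg1 hsymm hdet, hpd,
    matrixPd_fieldGradient hg hsymm hdet.ne, fieldGradient]
  simp only [add_mul, sub_mul, Matrix.add_apply, Matrix.sub_apply, Matrix.smul_mul,
    Matrix.smul_apply, smul_eq_mul]
  ring

theorem sqrt_neg_det_mul_current (hg : ∀ i j, ContDiffAt ℝ 2 (fun y => g y i j) x)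
    (hsymm : ∀ y, (g y).IsSymm) (hdet : (g x).det < 0)
    (hinv : ∀ y t, (g (Function.update y μ t)).det = (g y).det) {κ : Fin 4} (hκ : κ ≠ μ) :
    √(-(g x).det) * current g (fun _ => Pi.single μ 1) κ x =
      ∑ α, pd α (fun y => √(-(g y).det) * fieldGradient g μ y α κ) x -
        √(-(g x).det) * (1 / 2 * ∑ α, ∑ ε,
          christoffel g κ α ε x * pd μ (fun y => (g y)⁻¹ α ε) x) := by
  have hcurrent : current g (fun _ => Pi.single μ 1) κ x =
      ∑ β, (g x)⁻¹ κ β * ricci g β μ x := by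
    simp [current_eq_ricci _ (hsymm x) hdet.ne, Pi.single_apply, hκ]
  rw [hcurrent, sum_pd_sqrt_neg_det_mul_fieldGradient hg hsymm hdet hinv,
    sum_fieldGradient_mul_transpose (fun i j => (hg i j).of_le one_le_two) hsymm hdet.ne]
  ring

end CurrentIdentity

section Metric

variable {a : ℝ} {M : ℝ → ℝ} {x : Coord}

theorem rhoSq_pos (hr : 0 < x 1) : 0 < rhoSq a x := by
  unfold rhoSq; positivity

theorem isSymm_metric (a : ℝ) (M : ℝ → ℝ) (x : Coord) : (metric a M x).IsSymm := by
  ext i j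
  fin_cases i <;> fin_cases j <;> rfl

theorem det_metric (a : ℝ) (M : ℝ → ℝ) (x : Coord) :
    (metric a M x).det = -(rhoSq a x * sin (x 2)) ^ 2 := by
  rcases eq_or_ne (rhoSq a x) 0 with hR | hR
  · rw [Matrix.det_eq_zero_of_row_eq_zero 2 fun j => by fin_cases j <;> simp [metric, hR], hR]
    ring
  · simp [Matrix.det_succ_row_zero, Fin.sum_univ_succ, metric, Fin.succAbove]
    field_simp
    simp only [rhoSq, Gam, Delta, cos_sq']
    ring

theorem det_metric_neg (hr : 0 < x 1) (hs : 0 < sin (x 2)) : (metric a M x).det < 0 := by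
  rw [det_metric, neg_lt_zero]
  exact pow_pos (mul_pos (rhoSq_pos hr) hs) 2

theorem sqrt_neg_det_metric (hs : 0 < sin (x 2)) :
    √(-(metric a M x).det) = rhoSq a x * sin (x 2) := by
  have hR : 0 ≤ rhoSq a x := by unfold rhoSq; positivity
  rw [det_metric, neg_neg, sqrt_sq (by positivity)]

/-- The inverse of the Kerr-Vaidya metric. -/
noncomputable def inverseMetric (a : ℝ) (M : ℝ → ℝ) (x : Coord) : Matrix (Fin 4) (Fin 4) ℝ :=
  !![a ^ 2 * sin (x 2) ^ 2 / rhoSq a x, Gam a x / rhoSq a x, 0, a / rhoSq a x;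
     Gam a x / rhoSq a x, Delta a M x / rhoSq a x, 0, a / rhoSq a x;
     0, 0, 1 / rhoSq a x, 0;
     a / rhoSq a x, a / rhoSq a x, 0, 1 / (rhoSq a x * sin (x 2) ^ 2)]

theorem inv_metric (hr : 0 < x 1) (hs : 0 < sin (x 2)) :
    (metric a M x)⁻¹ = inverseMetric a M x := by
  have hR := (rhoSq_pos (a := a) hr).ne'
  refine Matrix.inv_eq_right_inv ?_
  ext i j
  fin_cases i <;> fin_cases j <;>
    simp [Matrix.mul_apply, Fin.sum_univ_four, metric, inverseMetric] <;>
    field_simp <;> simp only [rhoSq, Gam, Delta, cos_sq'] <;> ring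

theorem contDiffAt_metric (hM : ContDiff ℝ 2 M) (hr : 0 < x 1) (i j : Fin 4) :
    ContDiffAt ℝ 2 (fun y => metric a M y i j) x := by
  have hR : x 1 ^ 2 + a ^ 2 * cos (x 2) ^ 2 ≠ 0 := (rhoSq_pos hr).ne'
  fin_cases i <;> fin_cases j <;>
    simp only [metric, rhoSq, Gam, Delta, Matrix.of_apply, Matrix.cons_val, Fin.zero_eta,
      Fin.mk_one, Fin.reduceFinMk] <;>
    fun_prop (disch := assumption)

theorem eventually_radial_pos_sin_pos (hr : 0 < x 1) (hs : 0 < sin (x 2)) :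
    ∀ᶠ y in 𝓝 x, 0 < y 1 ∧ 0 < sin (y 2) :=
  ((continuous_apply 1).tendsto x |>.eventually_const_lt hr).and
    ((continuous_sin.comp (continuous_apply 2)).tendsto x |>.eventually_const_lt hs)

end Metric

section KerrSchild

variable {a : ℝ} {M : ℝ → ℝ} {x : Coord}

/-- The Kerr-Schild profile `f = 2 M(v) r / ρ²`: the metric is `f ℓ ⊗ ℓ` plus a flat metric, with
`ℓ = dv - a sin² ϑ dψ`. -/
noncomputable def kerrSchildProfile (a : ℝ) (M : ℝ → ℝ) (x : Coord) : ℝ :=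
  2 * M (x 0) * x 1 / rhoSq a x

theorem differentiableAt_kerrSchildProfile (hM : Differentiable ℝ M) (hr : 0 < x 1) :
    DifferentiableAt ℝ (kerrSchildProfile a M) x := by
  have hR : x 1 ^ 2 + a ^ 2 * cos (x 2) ^ 2 ≠ 0 := (rhoSq_pos hr).ne'
  unfold kerrSchildProfile rhoSq
  fun_prop (disch := assumption)

theorem pd_kerrSchildProfile_zero :
    pd 0 (kerrSchildProfile a M) x = 2 * deriv M (x 0) * x 1 / rhoSq a x := by
  simp [pd, kerrSchildProfile, rhoSq]

theorem pd_kerrSchildProfile_one (hr : 0 < x 1) :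
    pd 1 (kerrSchildProfile a M) x =
      2 * M (x 0) * (rhoSq a x - 2 * x 1 ^ 2) / rhoSq a x ^ 2 := by
  have hR : x 1 ^ 2 + a ^ 2 * cos (x 2) ^ 2 ≠ 0 := (rhoSq_pos hr).ne'
  have hnum : HasDerivAt (fun t => 2 * M (x 0) * t) (2 * M (x 0) * 1) (x 1) :=
    (hasDerivAt_id _).const_mul _
  have hden := (hasDerivAt_pow 2 (x 1)).add_const (a ^ 2 * cos (x 2) ^ 2)
  refine (hnum.div hden hR).deriv.trans ?_
  simp only [rhoSq]
  field

theorem pd_kerrSchildProfile_two (hr : 0 < x 1) :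
    pd 2 (kerrSchildProfile a M) x =
      kerrSchildProfile a M x * (2 * a ^ 2 * cos (x 2) * sin (x 2)) / rhoSq a x := by
  have hR : x 1 ^ 2 + a ^ 2 * cos (x 2) ^ 2 ≠ 0 := (rhoSq_pos hr).ne'
  have hden := (((hasDerivAt_cos (x 2)).fun_pow 2).const_mul (a ^ 2)).const_add (x 1 ^ 2)
  refine ((hasDerivAt_const _ (2 * M (x 0) * x 1)).div hden hR).deriv.trans ?_
  simp only [kerrSchildProfile, rhoSq]
  field

theorem pd_kerrSchildProfile_three : pd 3 (kerrSchildProfile a M) x = 0 :=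
  pd_eq_zero_of_forall_update 3 fun y t => by simp [kerrSchildProfile, rhoSq]

theorem metric_apply_zero (δ : Fin 4) :
    metric a M x δ 0 = ![kerrSchildProfile a M x - 1, 1, 0,
      -(a * sin (x 2) ^ 2 * kerrSchildProfile a M x)] δ := by
  fin_cases δ <;> simp [metric, kerrSchildProfile]
  ring

theorem loweredCurl_metric (hM : Differentiable ℝ M) (hr : 0 < x 1) :
    loweredCurl (metric a M) 0 x =
      let f := kerrSchildProfile a M
      let s := sin (x 2)
      !![0, pd 1 f x, pd 2 f x, a * s ^ 2 * pd 0 f x;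
         -pd 1 f x, 0, 0, a * s ^ 2 * pd 1 f x;
         -pd 2 f x, 0, 0, a * (2 * s * cos (x 2) * f x + s ^ 2 * pd 2 f x);
         -(a * s ^ 2 * pd 0 f x), -(a * s ^ 2 * pd 1 f x),
         -(a * (2 * s * cos (x 2) * f x + s ^ 2 * pd 2 f x)), 0] := by
  have hf := differentiableAt_kerrSchildProfile (a := a) hM hr
  have hzero : ∀ μ, pd μ (fun y => kerrSchildProfile a M y - 1) x =
      pd μ (kerrSchildProfile a M) x := fun μ => deriv_sub_const 1
  have hsq : ∀ μ, pd μ (fun y => -(a * sin (y 2) ^ 2)) x =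
      ![0, 0, -(2 * a * sin (x 2) * cos (x 2)), 0] μ := fun μ => by
    fin_cases μ <;> simp [pd, mul_assoc, mul_left_comm]
  have hthree : ∀ μ, pd μ (fun y => -(a * sin (y 2) ^ 2 * kerrSchildProfile a M y)) x =
      ![0, 0, -(2 * a * sin (x 2) * cos (x 2)), 0] μ * kerrSchildProfile a M x +
        -(a * sin (x 2) ^ 2) * pd μ (kerrSchildProfile a M) x := fun μ => by
    rw [← hsq, ← pd_mul μ (by fun_prop) hf]
    simp only [neg_mul]
  ext δ β
  simp only [loweredCurl, metric_apply_zero]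
  fin_cases δ <;> fin_cases β <;>
    simp [hzero, hthree, pd_const, pd_kerrSchildProfile_three] <;> ring

theorem matrixPd_inv_metric (hr : 0 < x 1) (hs : 0 < sin (x 2)) :
    matrixPd 0 (fun y => (metric a M y)⁻¹) x =
      Matrix.single 1 1 (-pd 0 (kerrSchildProfile a M) x) := by
  have hlocal : (fun y => (metric a M y)⁻¹) =ᶠ[𝓝 x] inverseMetric a M :=
    (eventually_radial_pos_sin_pos hr hs).mono fun y hy => inv_metric hy.1 hy.2
  ext i j
  refine (pd_congr 0 (hlocal.mono fun y hy => congrFun₂ hy i j)).trans ?_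
  rw [pd_kerrSchildProfile_zero]
  fin_cases i <;> fin_cases j <;> simp [pd, inverseMetric, rhoSq, Gam, Delta]
  ring

theorem christoffel_metric_one_one (α : Fin 4) : christoffel (metric a M) α 1 1 x = 0 := by
  have h : ∀ δ, pd 1 (fun y => metric a M y δ 1) x = 0 := fun δ =>
    pd_eq_zero_of_forall_update 1 fun y t => by fin_cases δ <;> simp [metric]
  have h' : ∀ δ, pd δ (fun y => metric a M y 1 1) x = 0 := fun δ => pd_const δ 0
  simp [christoffel, h, h']

end KerrSchild

section Superpotential

variable {a : ℝ} {M : ℝ → ℝ} {x : Coord}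

/-- The polar profile multiplying `M` in the `(v, r)` component of the superpotential. -/
noncomputable def komarProfile (a r θ : ℝ) : ℝ :=
  (r ^ 2 + a ^ 2) * (r ^ 2 - a ^ 2 * cos θ ^ 2) * sin θ / (r ^ 2 + a ^ 2 * cos θ ^ 2) ^ 2

/-- The polar profile multiplying `-M'` in the `(v, r)` component of the superpotential. -/
noncomputable def fluxProfile (a r θ : ℝ) : ℝ :=
  r * a ^ 2 * sin θ ^ 3 / (r ^ 2 + a ^ 2 * cos θ ^ 2)

/-- The components `√(-g) ∇^r K^α` of the gradient of the Kodama-like field. -/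
noncomputable def superpotential (a : ℝ) (M : ℝ → ℝ) (x : Coord) : Fin 4 → ℝ :=
  ![M (x 0) * komarProfile a (x 1) (x 2) - deriv M (x 0) * fluxProfile a (x 1) (x 2),
    deriv M (x 0) * x 1 * sin (x 2), 0,
    -(a * sin (x 2) / 2 * (pd 1 (kerrSchildProfile a M) x + pd 0 (kerrSchildProfile a M) x))]

theorem sqrt_neg_det_mul_fieldGradient_metric (hM : ContDiff ℝ 2 M) (hr : 0 < x 1)
    (hs : 0 < sin (x 2)) (α : Fin 4) :
    √(-(metric a M x).det) * fieldGradient (metric a M) 0 x α 1 = superpotential a M x α := by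
  have hR := (rhoSq_pos (a := a) hr).ne'
  rw [sqrt_neg_det_metric hs, fieldGradient_eq
    (fun i j => (contDiffAt_metric hM hr i j).of_le one_le_two) (det_metric_neg hr hs).ne,
    inv_metric hr hs, matrixPd_inv_metric hr hs,
    loweredCurl_metric (hM.differentiable two_ne_zero) hr]
  simp only [pd_kerrSchildProfile_zero, pd_kerrSchildProfile_one hr, pd_kerrSchildProfile_two hr,
    superpotential, kerrSchildProfile, komarProfile, fluxProfile, inverseMetric, Matrix.smul_apply,
    Matrix.sub_apply, Matrix.mul_apply, Matrix.single_apply, Fin.sum_univ_four, Matrix.of_apply,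
    Matrix.cons_val, show x 1 ^ 2 + a ^ 2 * cos (x 2) ^ 2 = rhoSq a x from rfl]
  fin_cases α <;> simp [-mul_eq_zero] <;> field_simp <;>
    simp only [rhoSq, Gam, Delta, cos_sq'] <;> ring

-- The failure of `∂_v` to be Killing lies in `g^{rr}` only, and is annihilated by `Γ^r_{rr} = 0`.
theorem sum_christoffel_mul_pd_inv_metric (hr : 0 < x 1) (hs : 0 < sin (x 2)) (κ : Fin 4) :
    ∑ α, ∑ ε, christoffel (metric a M) κ α ε x * pd 0 (fun y => (metric a M y)⁻¹ α ε) x = 0 := by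
  refine Finset.sum_eq_zero fun α _ => Finset.sum_eq_zero fun ε _ => ?_
  have hpd : pd 0 (fun y => (metric a M y)⁻¹ α ε) x =
      Matrix.single 1 1 (-pd 0 (kerrSchildProfile a M) x) α ε :=
    congrFun₂ (matrixPd_inv_metric hr hs) α ε
  rw [hpd, Matrix.single_apply]
  split_ifs with h
  · rw [← h.1, ← h.2, christoffel_metric_one_one, zero_mul]
  · rw [mul_zero]

theorem sum_pd_superpotential (hM : ContDiff ℝ 2 M) :
    ∑ α, pd α (fun y => superpotential a M y α) x =
      deriv M (x 0) * (komarProfile a (x 1) (x 2) + sin (x 2)) -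
        deriv (deriv M) (x 0) * fluxProfile a (x 1) (x 2) := by
  have hM1 : DifferentiableAt ℝ M (x 0) := hM.differentiable two_ne_zero _
  have hM2 : DifferentiableAt ℝ (deriv M) (x 0) := hM.differentiable_deriv_two _
  have hv : pd 0 (fun y => superpotential a M y 0) x =
      deriv M (x 0) * komarProfile a (x 1) (x 2) -
        deriv (deriv M) (x 0) * fluxProfile a (x 1) (x 2) := by
    have h := (hM1.hasDerivAt.mul_const (komarProfile a (x 1) (x 2))).fun_sub
      (hM2.hasDerivAt.mul_const (fluxProfile a (x 1) (x 2)))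
    simpa [pd, superpotential] using h.deriv
  have hr : pd 1 (fun y => superpotential a M y 1) x = deriv M (x 0) * sin (x 2) := by
    simp [pd, superpotential]
  have hθ : pd 2 (fun y => superpotential a M y 2) x = 0 := pd_const 2 0
  have hψ : pd 3 (fun y => superpotential a M y 3) x = 0 := by
    have hf : ∀ y t, kerrSchildProfile a M (Function.update y 3 t) = kerrSchildProfile a M y :=
      fun y t => by simp [kerrSchildProfile, rhoSq]
    exact pd_eq_zero_of_forall_update 3 fun y t => by
      simp [superpotential, pd_update_of_forall_update 3 hf]
  rw [Fin.sum_univ_four, hv, hr, hθ, hψ]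
  ring

theorem sqrt_neg_det_mul_current_metric (hM : ContDiff ℝ 2 M) (hr : 0 < x 1)
    (hs : 0 < sin (x 2)) :
    √(-(metric a M x).det) * current (metric a M) kodamaField 1 x =
      deriv M (x 0) * (komarProfile a (x 1) (x 2) + sin (x 2)) -
        deriv (deriv M) (x 0) * fluxProfile a (x 1) (x 2) := by
  have hinv : ∀ y t, (metric a M (Function.update y 0 t)).det = (metric a M y).det := fun y t => by
    simp [det_metric, rhoSq]
  have hK : kodamaField = fun _ => Pi.single 0 1 := by
    funext _ i
    fin_cases i <;> rfl
  have hpot : ∀ α, pd α (fun y => √(-(metric a M y).det) * fieldGradient (metric a M) 0 y α 1) x =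
      pd α (fun y => superpotential a M y α) x := fun α =>
    pd_congr α ((eventually_radial_pos_sin_pos hr hs).mono fun y hy =>
      sqrt_neg_det_mul_fieldGradient_metric hM hy.1 hy.2 α)
  rw [hK, sqrt_neg_det_mul_current (contDiffAt_metric hM hr) (isSymm_metric a M)
    (det_metric_neg hr hs) hinv one_ne_zero, sum_christoffel_mul_pd_inv_metric hr hs,
    mul_zero, mul_zero, sub_zero]
  simp only [hpot, sum_pd_superpotential hM]

theorem chargeDensity_eq (hM : ContDiff ℝ 2 M) {r v : ℝ} (hr : 0 < r) {p : ℝ × ℝ × ℝ}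
    (hp : p ∈ sigma v) :
    chargeDensity a M r p = deriv M p.1 * (komarProfile a r p.2.1 + sin p.2.1) -
      deriv (deriv M) p.1 * fluxProfile a r p.2.1 := by
  have hs : 0 < sin p.2.1 := sin_pos_of_mem_Ioo hp.2.1
  calc chargeDensity a M r p
      = √(-(metric a M (embed r p)).det) * current (metric a M) kodamaField 1 (embed r p) := by
        simp [chargeDensity, normalCovector, Fin.sum_univ_four, mul_comm]
    _ = _ := sqrt_neg_det_mul_current_metric (x := embed r p) hM hr hs

end Superpotential

section PolarIntegrals

theorem integral_Ioo_eq_sub {f F : ℝ → ℝ} (hf : Continuous f) (hF : ∀ x, HasDerivAt F (f x) x)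
    {b c : ℝ} (hbc : b ≤ c) : ∫ x in Ioo b c, f x = F c - F b := by
  rw [← integral_Ioc_eq_integral_Ioo, ← intervalIntegral.integral_of_le hbc]
  exact intervalIntegral.integral_eq_sub_of_hasDerivAt (fun x _ => hF x) (hf.intervalIntegrable _ _)

theorem integral_sin_Ioo : ∫ θ in Ioo 0 π, sin θ = 2 := by
  rw [← integral_Ioc_eq_integral_Ioo, ← intervalIntegral.integral_of_le pi_pos.le, integral_sin]
  norm_num

variable {a r : ℝ}

theorem continuous_komarProfile (hr : 0 < r) : Continuous (komarProfile a r) := by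
  unfold komarProfile
  exact Continuous.div (by fun_prop) (by fun_prop) fun θ => by positivity

theorem continuous_fluxProfile (hr : 0 < r) : Continuous (fluxProfile a r) := by
  unfold fluxProfile
  exact Continuous.div (by fun_prop) (by fun_prop) fun θ => by positivity

theorem integral_komarProfile (hr : 0 < r) : ∫ θ in Ioo 0 π, komarProfile a r θ = 2 := by
  have hF : ∀ θ, HasDerivAt (fun t => -(r ^ 2 + a ^ 2) * cos t / (r ^ 2 + a ^ 2 * cos t ^ 2))
      (komarProfile a r θ) θ := fun θ => by
    have hR : r ^ 2 + a ^ 2 * cos θ ^ 2 ≠ 0 := by positivity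
    have hden := (((hasDerivAt_cos θ).fun_pow 2).const_mul (a ^ 2)).const_add (r ^ 2)
    refine (((hasDerivAt_cos θ).const_mul (-(r ^ 2 + a ^ 2))).div hden hR).congr_deriv ?_
    simp only [komarProfile]
    field
  have hR : r ^ 2 + a ^ 2 ≠ 0 := by positivity
  rw [integral_Ioo_eq_sub (continuous_komarProfile hr) hF pi_pos.le]
  simp only [cos_pi, cos_zero]
  field

theorem integral_fluxProfile (ha : a ≠ 0) (hr : 0 < r) :
    ∫ θ in Ioo 0 π, fluxProfile a r θ = 2 * ((r ^ 2 + a ^ 2) / a * arctan (a / r) - r) := by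
  have hF : ∀ θ, HasDerivAt (fun t => r * cos t - (r ^ 2 + a ^ 2) / a * arctan (a / r * cos t))
      (fluxProfile a r θ) θ := fun θ => by
    have hR : r ^ 2 + a ^ 2 * cos θ ^ 2 ≠ 0 := by positivity
    have hsq : 1 + (a / r * cos θ) ^ 2 = (r ^ 2 + a ^ 2 * cos θ ^ 2) / r ^ 2 := by field_simp
    refine (((hasDerivAt_cos θ).const_mul r).sub (((hasDerivAt_cos θ).const_mul
      (a / r)).arctan.const_mul ((r ^ 2 + a ^ 2) / a))).congr_deriv ?_
    rw [hsq, fluxProfile]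
    field_simp
    simp only [cos_sq']
    ring
  rw [integral_Ioo_eq_sub (continuous_fluxProfile hr) hF pi_pos.le]
  simp only [cos_pi, cos_zero, mul_neg, mul_one, arctan_neg]
  ring

theorem integral_fluxProfile_zero (r : ℝ) : ∫ θ in Ioo 0 π, fluxProfile 0 r θ = 0 := by
  simp [fluxProfile]

theorem abs_fluxProfile_le (hr : 0 < r) (θ : ℝ) : |fluxProfile a r θ| ≤ a ^ 2 / r := by
  have hsin : |sin θ ^ 3| ≤ 1 := by
    rw [abs_pow]
    exact pow_le_one₀ (abs_nonneg _) (abs_sin_le_one θ)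
  have hR : r ^ 2 ≤ r ^ 2 + a ^ 2 * cos θ ^ 2 := le_add_of_nonneg_right (by positivity)
  calc |fluxProfile a r θ| = r * a ^ 2 * |sin θ ^ 3| / (r ^ 2 + a ^ 2 * cos θ ^ 2) := by
        rw [fluxProfile, abs_div, abs_mul, abs_of_nonneg (by positivity : 0 ≤ r * a ^ 2),
          abs_of_pos (by positivity : 0 < r ^ 2 + a ^ 2 * cos θ ^ 2)]
    _ ≤ r * a ^ 2 * 1 / r ^ 2 := by gcongr
    _ = a ^ 2 / r := by field_simp

theorem tendsto_integral_fluxProfile (a : ℝ) :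
    Tendsto (fun r => ∫ θ in Ioo 0 π, fluxProfile a r θ) atTop (𝓝 0) := by
  have hbound : Tendsto (fun r : ℝ => a ^ 2 / r * volume.real (Ioo 0 π)) atTop (𝓝 0) := by
    simpa using (tendsto_id.const_div_atTop (a ^ 2)).mul_const (volume.real (Ioo 0 π))
  refine squeeze_zero_norm' ?_ hbound
  filter_upwards [eventually_gt_atTop 0] with r hr
  exact norm_setIntegral_le_of_norm_le_const (by simp) fun θ _ => abs_fluxProfile_le hr θ

end PolarIntegrals

section Charge

theorem measurableSet_sigma (v : ℝ) : MeasurableSet (sigma v) :=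
  measurableSet_Iic.prod (measurableSet_Ioo.prod measurableSet_Ioo)

theorem integrableOn_sigma {m f : ℝ → ℝ} {v : ℝ} (hm : IntegrableOn m (Iic v))
    (hf : Continuous f) :
    IntegrableOn (fun p : ℝ × ℝ × ℝ => m p.1 * f p.2.1) (sigma v) := by
  have hψ : IntegrableOn (fun _ : ℝ => (1 : ℝ)) (Ioo 0 (2 * π)) :=
    integrableOn_const measure_Ioo_lt_top.ne
  have hθ : IntegrableOn f (Ioo 0 π) := hf.integrableOn_Icc.mono_set Ioo_subset_Icc_self
  have h := hm.mul_prod (hθ.mul_prod hψ)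
  simp only [Measure.prod_restrict, mul_one] at h
  exact h

theorem integral_sigma (m f : ℝ → ℝ) (v : ℝ) :
    ∫ p in sigma v, m p.1 * f p.2.1 =
      (∫ t in Iic v, m t) * ((∫ θ in Ioo 0 π, f θ) * (2 * π)) := by
  have hangle : ∫ q in Ioo 0 π ×ˢ Ioo 0 (2 * π), f q.1 = (∫ θ in Ioo 0 π, f θ) * (2 * π) := by
    have h := setIntegral_prod_mul (μ := volume) (ν := volume) f (fun _ : ℝ => (1 : ℝ)) (Ioo 0 π)
      (Ioo 0 (2 * π))
    simpa [pi_pos.le, ← Measure.volume_eq_prod] using h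
  rw [← hangle]
  exact setIntegral_prod_mul m (fun q : ℝ × ℝ => f q.1) (Iic v) (Ioo 0 π ×ˢ Ioo 0 (2 * π))

variable {a m₀ r v : ℝ} {M : ℝ → ℝ}

theorem integrableOn_chargeDensity (hM : ContDiff ℝ 2 M) (hr : 0 < r)
    (hM1 : IntegrableOn (deriv M) (Iic v)) (hM2 : IntegrableOn (deriv (deriv M)) (Iic v)) :
    IntegrableOn (chargeDensity a M r) (sigma v) :=
  ((integrableOn_sigma hM1 ((continuous_komarProfile hr).add continuous_sin)).sub
    (integrableOn_sigma hM2 (continuous_fluxProfile hr))).congr_fun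
      (fun _ hp => (chargeDensity_eq hM hr hp).symm) (measurableSet_sigma v)

theorem charge_eq (hM : ContDiff ℝ 2 M) (hr : 0 < r) (hM0 : Tendsto M atBot (𝓝 m₀))
    (hM1 : IntegrableOn (deriv M) (Iic v)) (hM2 : IntegrableOn (deriv (deriv M)) (Iic v)) :
    charge a M r v = M v - m₀ - deriv M v * ((∫ θ in Ioo 0 π, fluxProfile a r θ) / 4) := by
  have hd1 : ∀ t, HasDerivAt M (deriv M t) t := fun t =>
    (hM.differentiable two_ne_zero t).hasDerivAt
  have hd2 : ∀ t, HasDerivAt (deriv M) (deriv (deriv M) t) t := fun t =>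
    (hM.differentiable_deriv_two t).hasDerivAt
  have hlim : Tendsto (deriv M) atBot (𝓝 0) :=
    tendsto_zero_of_hasDerivAt_of_integrableOn_Iic (fun t _ => hd2 t) hM2 hM1
  have hcont : Continuous fun θ => komarProfile a r θ + sin θ :=
    (continuous_komarProfile hr).add continuous_sin
  have hfour : ∫ θ in Ioo 0 π, (komarProfile a r θ + sin θ) = 4 := by
    rw [integral_add ((continuous_komarProfile hr).integrableOn_Icc.mono_set Ioo_subset_Icc_self)
      (continuous_sin.integrableOn_Icc.mono_set Ioo_subset_Icc_self), integral_komarProfile hr,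
      integral_sin_Ioo]
    norm_num
  rw [charge, setIntegral_congr_fun (measurableSet_sigma v) fun _ hp => chargeDensity_eq hM hr hp,
    integral_sub (integrableOn_sigma hM1 hcont)
      (integrableOn_sigma hM2 (continuous_fluxProfile hr)),
    integral_sigma _ (fun θ => komarProfile a r θ + sin θ), integral_sigma, hfour,
    integral_Iic_of_hasDerivAt_of_tendsto' (fun t _ => hd1 t) hM1 hM0,
    integral_Iic_of_hasDerivAt_of_tendsto' (fun t _ => hd2 t) hM2 hlim]
  field

end Charge

end KerrVaidya

theorem proposition3_general {a m₀ : ℝ} {M : ℝ → ℝ} (hM : ContDiff ℝ 2 M)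
    (hM0 : Tendsto M atBot (𝓝 m₀)) {v : ℝ}
    (hM1 : IntegrableOn (deriv M) (Iic v)) (hM2 : IntegrableOn (deriv (deriv M)) (Iic v)) :
    (∀ r : ℝ, 0 < r →
      IntegrableOn (KerrVaidya.chargeDensity a M r) (KerrVaidya.sigma v) ∧
      (a ≠ 0 → KerrVaidya.charge a M r v =
        M v - m₀ - deriv M v * ((r ^ 2 + a ^ 2) / (2 * a) * arctan (a / r) - r / 2)) ∧
      (a = 0 → KerrVaidya.charge a M r v = M v - m₀)) ∧
    Tendsto (fun r : ℝ => KerrVaidya.charge a M r v) atTop (𝓝 (M v - m₀)) := by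
  have hcharge (r : ℝ) (hr : 0 < r) : KerrVaidya.charge a M r v =
      M v - m₀ - deriv M v * ((∫ θ in Ioo 0 π, KerrVaidya.fluxProfile a r θ) / 4) :=
    KerrVaidya.charge_eq hM hr hM0 hM1 hM2
  refine ⟨fun r hr => ⟨KerrVaidya.integrableOn_chargeDensity hM hr hM1 hM2, fun ha => ?_,
    fun ha => ?_⟩, ?_⟩
  · rw [hcharge r hr, KerrVaidya.integral_fluxProfile ha hr]
    ring
  · rw [hcharge r hr, ha, KerrVaidya.integral_fluxProfile_zero, zero_div, mul_zero, sub_zero]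
  · have hlim := (((KerrVaidya.tendsto_integral_fluxProfile a).div_const 4).const_mul
      (deriv M v)).const_sub (M v - m₀)
    rw [zero_div, mul_zero, sub_zero] at hlim
    refine hlim.congr' ?_
    filter_upwards [eventually_gt_atTop 0] with r hr using (hcharge r hr).symm

theorem proposition3 (a : ℝ) (M : ℝ → ℝ) (hM : ContDiff ℝ 2 M)
    (hM0 : Tendsto M atBot (𝓝 0)) (v : ℝ)
    (hM1 : IntegrableOn (deriv M) (Iic v)) (hM2 : IntegrableOn (deriv (deriv M)) (Iic v)) :
    (∀ r : ℝ, 0 < r →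
      IntegrableOn (KerrVaidya.chargeDensity a M r) (KerrVaidya.sigma v) ∧
      (a ≠ 0 → KerrVaidya.charge a M r v =
        M v - deriv M v * ((r ^ 2 + a ^ 2) / (2 * a) * arctan (a / r) - r / 2)) ∧
      (a = 0 → KerrVaidya.charge a M r v = M v)) ∧
    Tendsto (fun r : ℝ => KerrVaidya.charge a M r v) atTop (𝓝 (M v)) := by
  simpa only [sub_zero] using proposition3_general hM hM0 hM1 hM2
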